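/- A skew brace is a triple $(B,+,\circ)$ such that $(B,+)$ and $(B,\circ)$ are groups and $a\circ(b+c)=a\circ b-a+a\circ c$ for all $a,b,c\in B$; it is of abelian type if $(B,+)$ is abelian. The group $(B,\circ)$ acts on $(B,+)$ by the automorphisms $\lambda_a(b)=-a+a\circ b$. The $\lambda$-graph $\Lambda(B)$ of a finite skew brace $B$ has as vertices the orbits of this action with more than one element, two different orbits being adjacent if and only if their sizes are not coprime. **Theorem.** Let $B$ be a finite skew brace of abelian type such that $\Lambda(B)$ has exactly one vertex. Then $B$ is isomorphic (as a skew brace) to one of the following skew braces, in which $+$ is the usual addition: - the skew brace on $\mathbb{Z}/4\mathbb{Z}$ with $x\circ y=x+y+2xy$; - the skew brace on $\mathbb{Z}/2\mathbb{Z}\times\mathbb{Z}/2\mathbb{Z}$ with $$(x_1,y_1)\circ(x_2,y_2)=(x_1+x_2+y_1y_2,\;y_1+y_2);$$ - the skew brace on $\mathbb{Z}/2\mathbb{Z}\times\mathbb{Z}/4\mathbb{Z}$ with $$(x_1,y_1)\circ(x_2,y_2)=\Bigl(x_1+x_2+y_2\sum_{i=1}^{y_1-1}i,\;y_1+y_2+2y_1y_2\Bigr),$$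 where in the sum $y_1$ is represented by an element of $\{0,1,2,3\}$ (the sum is $0$ if $y_1\in\{0,1\}$), and the product $y_2\sum_{i=1}^{y_1-1}i$ is taken modulo $2$. In particular, $|B|\le 8$. -/

import Mathlib

universe u v w

/-- A skew brace `(A, +, ∘)`: `(A, +)` and `(A, ∘)` are groups (neither is assumed commutative) with
`a ∘ (b + c) = a ∘ b - a + a ∘ c`. The operation `∘` is written as the multiplication `*`. -/
class SkewBrace (A : Type u) extends AddGroup A, Group A where
  circ_add : ∀ a b c : A, a * (b + c) = a * b - a + a * c

namespace SkewBrace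

/-- `A` is of abelian type: the additive group `(A, +)` is abelian. -/
def IsOfAbelianType (A : Type u) [SkewBrace A] : Prop :=
  ∀ a b : A, a + b = b + a

/-- An isomorphism of skew braces: a bijection preserving both operations. -/
structure Iso (A : Type u) (B : Type v) [SkewBrace A] [SkewBrace B] extends A ≃ B where
  map_add' : ∀ x y : A, toFun (x + y) = toFun x + toFun y
  map_circ' : ∀ x y : A, toFun (x * y) = toFun x * toFun y

section Lambda

variable {A : Type u} [SkewBrace A]

theorem circ_zero (a : A) : a * (0 : A) = a := by
  have h := circ_add a 0 0
  rw [add_zero, sub_eq_add_neg, add_assoc] at h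
  have h2 : -a + a * (0 : A) = 0 := by
    simpa using h
  exact (neg_add_eq_zero.mp h2).symm

theorem zero_eq_one : (0 : A) = 1 := by
  have h := circ_zero (1 : A)
  rwa [one_mul] at h

/-- The additive automorphism `λ_a : b ↦ -a + a ∘ b`. -/
def lambdaAut (a : A) : AddAut A where
  toFun b := -a + a * b
  invFun b := a⁻¹ * (a + b)
  left_inv b := by simp
  right_inv b := by simp
  map_add' b c := by
    rw [circ_add]
    simp only [sub_eq_add_neg, add_assoc]

/-- The homomorphism `λ : (A, ∘) → Aut(A, +)`, `λ_a(b) = -a + a ∘ b`. (Mathlib writes the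
composition group `AddAut A` additively, hence `Multiplicative`.) -/
def lambda (A : Type u) [SkewBrace A] : A →* Multiplicative (AddAut A) where
  toFun a := Multiplicative.ofAdd (lambdaAut a)
  map_one' := by
    refine congrArg Multiplicative.ofAdd (AddEquiv.ext fun b => ?_)
    change -(1 : A) + 1 * b = b
    rw [one_mul, ← zero_eq_one, neg_zero, zero_add]
  map_mul' a b := by
    refine congrArg Multiplicative.ofAdd (AddEquiv.ext fun c => ?_)
    change -(a * b) + a * b * c = -a + a * (-b + b * c)
    have h := circ_add a b (-b + b * c)
    rw [add_neg_cancel_left, ← mul_assoc] at h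
    rw [h]
    simp only [sub_eq_add_neg, add_assoc, neg_add_cancel_left]

end Lambda

end SkewBrace

section CommonDivisorGraph

variable {G : Type u} {H : Type v} [Group G] [AddGroup H]

/-- The orbit of `a` under an action of the group `G` on `H` by automorphisms. -/
def actionOrbit (α : G →* Multiplicative (AddAut H)) (a : H) : Set H :=
  Set.range fun g : G => (α g).toAdd a

/-- The non-trivial orbits (those with more than one element) of an action on a finite group. -/
def NontrivialOrbit (α : G →* Multiplicative (AddAut H)) : Type v :=
  {L : Set H // (∃ a : H, L = actionOrbit α a) ∧ 1 < L.ncard}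

/-- The common divisor graph of an action of `G` on a finite group `H` by automorphisms: its vertices
are the non-trivial orbits, and two different vertices are adjacent when their sizes are not
coprime. -/
def commonDivisorGraph (α : G →* Multiplicative (AddAut H)) : SimpleGraph (NontrivialOrbit α) where
  Adj L₁ L₂ := L₁ ≠ L₂ ∧ Nat.gcd L₁.1.ncard L₂.1.ncard ≠ 1
  symm := ⟨fun L₁ L₂ h => ⟨h.1.symm, by rw [Nat.gcd_comm]; exact h.2⟩⟩
  loopless := ⟨fun _ h => h.1 rfl⟩

end CommonDivisorGraph

/-- The `λ`-graph of a finite skew brace. -/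
def lambdaGraph (A : Type u) [SkewBrace A] : SimpleGraph (NontrivialOrbit (SkewBrace.lambda A)) :=
  commonDivisorGraph (SkewBrace.lambda A)

/-- The graph has exactly one vertex. -/
def HasExactlyOneVertex {V : Type w} (_Γ : SimpleGraph V) : Prop :=
  Nat.card V = 1

section Examples

/-- A skew brace on an additive group `A` from an operation `circ` on `A` (with neutral element `0`
and inverse `inv`). -/
abbrev SkewBrace.ofCirc (A : Type u) [AddGroup A] (circ : A → A → A) (inv : A → A)
    (assoc : ∀ a b c, circ (circ a b) c = circ a (circ b c))
    (zero_circ : ∀ a, circ 0 a = a) (inv_circ : ∀ a, circ (inv a) a = 0)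
    (circ_add : ∀ a b c, circ a (b + c) = circ a b - a + circ a c) : SkewBrace A :=
  letI : Mul A := ⟨circ⟩
  letI : Inv A := ⟨inv⟩
  letI : One A := ⟨0⟩
  { ‹AddGroup A›, Group.ofLeftAxioms assoc zero_circ inv_circ with
    circ_add := circ_add }

/-- `x ∘ y = x + y + 2xy` on `ℤ/4`. -/
def circZ4 (x y : ZMod 4) : ZMod 4 :=
  x + y + 2 * x * y

/-- The skew brace with additive group `ℤ/4` and circle operation `circZ4`. -/
def BraceZ4 : Type := ZMod 4

instance : SkewBrace BraceZ4 :=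
  SkewBrace.ofCirc (ZMod 4) circZ4 (fun x => x)
    (by decide)
    (by decide)
    (by decide)
    (by decide)

/-- `(x₁, y₁) ∘ (x₂, y₂) = (x₁ + x₂ + y₁y₂, y₁ + y₂)` on `ℤ/2 × ℤ/2`. -/
def circZ2Z2 (a b : ZMod 2 × ZMod 2) : ZMod 2 × ZMod 2 :=
  (a.1 + b.1 + a.2 * b.2, a.2 + b.2)

/-- The skew brace with additive group `ℤ/2 × ℤ/2` and circle operation `circZ2Z2`. -/
def BraceZ2Z2 : Type := ZMod 2 × ZMod 2

instance : SkewBrace BraceZ2Z2 :=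
  SkewBrace.ofCirc (ZMod 2 × ZMod 2) circZ2Z2 (fun a => (a.1 + a.2, a.2))
    (by decide)
    (by decide)
    (by decide)
    (by decide)

/-- `∑_{i=1}^{y-1} i` modulo 2, for the representative `y ∈ {0, 1, 2, 3}`. -/
def sumBelow (y : ZMod 4) : ZMod 2 :=
  ∑ i ∈ Finset.Ico 1 y.val, (i : ZMod 2)

/-- `(x₁, y₁) ∘ (x₂, y₂) = (x₁ + x₂ + y₂ ∑_{i=1}^{y₁-1} i, y₁ + y₂ + 2y₁y₂)` on `ℤ/2 × ℤ/4`, where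
`y₂` is reduced modulo 2 in the first component. -/
def circZ2Z4 (a b : ZMod 2 × ZMod 4) : ZMod 2 × ZMod 4 :=
  (a.1 + b.1 + (b.2.val : ZMod 2) * sumBelow a.2, a.2 + b.2 + 2 * a.2 * b.2)

/-- The skew brace with additive group `ℤ/2 × ℤ/4` and circle operation `circZ2Z4`. -/
def BraceZ2Z4 : Type := ZMod 2 × ZMod 4

instance : SkewBrace BraceZ2Z4 :=
  SkewBrace.ofCirc (ZMod 2 × ZMod 4) circZ2Z4
    (fun a => (a.1 + (a.2.val : ZMod 2) * sumBelow a.2, -(a.2 * (1 + 2 * a.2))))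
    (by decide +kernel)
    (by decide +kernel)
    (by decide +kernel)
    (by decide +kernel)

end Examples

/-! Let `F` be the subgroup of elements fixed by every `λ_a`. With a single nontrivial orbit, the
complement of `F` is that orbit; its size divides `|B|`, which forces index 2
(`index_fixedPoints_eq_two`). For `c ∉ F`, put `f a = -c + λ_a(c)`. Then `λ_a` is the identity on
`F` and translation by `f a` off `F`, so `f` determines the brace, and `f` is a homomorphism from
`(B, ∘)` onto `F` (`isShiftedAddition`).

Comparing `f` on sums and on circle products shows that `f ∘ f` vanishes on `F`, whence `F = {0, u,
v, u + v}` with `v = f c`, `u = f v` (`eq_of_mem`). So `|B| ≤ 8`, and only `u` and `c + c` are left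
to decide: `u = 0` gives order 4, with `c + c = 0` or `c + c = v`; for `u ≠ 0` one may choose `c`
with `c + c = v`. -/

/-- An operation on an abelian group `M` which agrees with `+` when the right argument lies in the
index two subgroup `F` of exponent two, and is otherwise shifted by a map `f` from `M` onto `F` that
turns the operation into addition. -/
structure IsShiftedAddition {M : Type*} [AddCommGroup M] (F : AddSubgroup M) (f : M → M)
    (circ : M → M → M) : Prop where
  index_eq_two : F.index = 2
  add_self : ∀ x ∈ F, x + x = 0
  map_mem : ∀ a, f a ∈ F
  exists_map_eq : ∀ x ∈ F, ∃ a, f a = x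
  circ_of_mem : ∀ a, ∀ b ∈ F, circ a b = a + b
  circ_of_notMem : ∀ a, ∀ b ∉ F, circ a b = a + b + f a
  map_circ : ∀ a b, f (circ a b) = f a + f b

/-! ### Shifted additions: bounding `F` -/

namespace IsShiftedAddition

variable {M : Type*} [AddCommGroup M] {F : AddSubgroup M} {f : M → M} {circ : M → M → M}

theorem map_add_of_mem (h : IsShiftedAddition F f circ) (a : M) {b : M} (hb : b ∈ F) :
    f (a + b) = f a + f b := by
  rw [← h.circ_of_mem a b hb, h.map_circ]

theorem map_zero (h : IsShiftedAddition F f circ) : f 0 = 0 := by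
  simpa using h.map_add_of_mem 0 F.zero_mem

theorem exists_notMem (h : IsShiftedAddition F f circ) : ∃ c, c ∉ F := by
  by_contra! hc
  have h1 : F = ⊤ := (AddSubgroup.eq_top_iff' F).2 hc
  have h2 := h.index_eq_two
  simp [h1] at h2

theorem map_add_of_notMem (h : IsShiftedAddition F f circ) (a : M) {b : M} (hb : b ∉ F) :
    f (a + b) + f (f a) = f a + f b := by
  rw [← h.map_add_of_mem _ (h.map_mem a), ← h.circ_of_notMem a b hb, h.map_circ]

/-- For `c ∉ F`, expand `f (a + c)` twice: once with `c` as the summand outside `F`, once with `a`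
as the summand inside. The two results differ by `f (f a)`. -/
theorem map_map_of_mem (h : IsShiftedAddition F f circ) {a : M} (ha : a ∈ F) : f (f a) = 0 := by
  obtain ⟨c, hc⟩ := h.exists_notMem
  have h1 := h.map_add_of_notMem a hc
  rwa [add_comm a c, h.map_add_of_mem c ha, add_comm (f c), add_eq_left] at h1

theorem sub_mem (h : IsShiftedAddition F f circ) {b c : M} (hb : b ∉ F) (hc : c ∉ F) :
    b - c ∈ F := by
  rw [sub_eq_add_neg, AddSubgroup.add_mem_iff_of_index_two h.index_eq_two, neg_mem_iff]
  tauto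

theorem add_mem (h : IsShiftedAddition F f circ) {b c : M} (hb : b ∉ F) (hc : c ∉ F) :
    b + c ∈ F := by
  rw [AddSubgroup.add_mem_iff_of_index_two h.index_eq_two]
  tauto

theorem map_eq_of_mem (h : IsShiftedAddition F f circ) {c x : M} (hc : c ∉ F) (hx : x ∈ F) :
    f x = 0 ∨ f x = f (f c) := by
  obtain ⟨y, rfl⟩ := h.exists_map_eq x hx
  by_cases hy : y ∈ F
  · exact .inl (h.map_map_of_mem hy)
  · have hz := h.sub_mem hy hc
    right
    rw [← add_sub_cancel c y, h.map_add_of_mem c hz, h.map_add_of_mem _ (h.map_mem _),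
      h.map_map_of_mem hz, add_zero]

/-- `F` is the image of `f`. On `F` the values of `f` are `0` or `f (f c)`, and on `c + F` they are
shifted by `f c`. -/
theorem eq_of_mem (h : IsShiftedAddition F f circ) {c x : M} (hc : c ∉ F) (hx : x ∈ F) :
    x = 0 ∨ x = f (f c) ∨ x = f c ∨ x = f c + f (f c) := by
  obtain ⟨y, rfl⟩ := h.exists_map_eq x hx
  by_cases hy : y ∈ F
  · rcases h.map_eq_of_mem hc hy with h1 | h1 <;> simp [h1]
  · have hz := h.sub_mem hy hc
    rw [← add_sub_cancel c y, h.map_add_of_mem c hz]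
    rcases h.map_eq_of_mem hc hz with h1 | h1 <;> simp [h1]

/-! ### Coordinates in the three cases -/

/-- The homomorphism from `ZMod n` sending `1` to `c`. -/
theorem exists_zmodHom (n : ℕ) (c : M) (hc : n • c = 0) : ∃ φ : ZMod n →+ M, φ 1 = c :=
  ⟨ZMod.lift n ⟨zmultiplesHom M c, by simpa using hc⟩, by
    simpa using ZMod.lift_coe n ⟨zmultiplesHom M c, by simpa using hc⟩ 1⟩

theorem exists_equiv_circZ4 (h : IsShiftedAddition F f circ) {c : M} (hc : c ∉ F)
    (hu : f (f c) = 0) (hv : f c ≠ 0) (hcc : c + c = f c) :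
    ∃ e : M ≃+ ZMod 4, ∀ a b, e (circ a b) = circZ4 (e a) (e b) := by
  have hvF := h.map_mem c
  have hvv := h.add_self _ hvF
  obtain ⟨φ, hφ⟩ := exists_zmodHom 4 c (by
    rw [show 4 • c = (c + c) + (c + c) by abel, hcc, hvv])
  have cases4 : ∀ y : ZMod 4, y = 0 ∨ y = 1 ∨ y = 2 ∨ y = 3 := by decide
  have h2 : φ 2 = f c := by
    rw [show (2 : ZMod 4) = 1 + 1 by decide, _root_.map_add, hφ, hcc]
  have h3 : φ 3 = c + f c := by
    rw [show (3 : ZMod 4) = 1 + 2 by decide, _root_.map_add, hφ, h2]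
  have hcv : c + f c ∉ F := by rwa [F.add_mem_cancel_right hvF]
  have inj : Function.Injective φ := by
    rw [injective_iff_map_eq_zero]
    intro y hy
    rcases cases4 y with rfl | rfl | rfl | rfl
    · rfl
    · exact absurd (hφ ▸ hy ▸ F.zero_mem) hc
    · exact absurd (h2 ▸ hy) hv
    · exact absurd (h3 ▸ hy ▸ F.zero_mem) hcv
  have surj : Function.Surjective φ := by
    have key : ∀ x ∈ F, ∃ y, φ y = x := by
      intro x hx
      rcases h.eq_of_mem hc hx with rfl | rfl | rfl | rfl
      · exact ⟨0, φ.map_zero⟩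
      · exact ⟨0, by rw [φ.map_zero, hu]⟩
      · exact ⟨2, h2⟩
      · exact ⟨2, by rw [h2, hu, add_zero]⟩
    intro b
    by_cases hb : b ∈ F
    · exact key b hb
    · obtain ⟨y, hy⟩ := key _ (h.sub_mem hb hc)
      exact ⟨y + 1, by rw [_root_.map_add, hy, hφ, sub_add_cancel]⟩
  have hf : ∀ y, f (φ y) = φ (2 * y) := by
    intro y
    rcases cases4 y with rfl | rfl | rfl | rfl
    · simp [h.map_zero]
    · rw [hφ, mul_one, h2]
    · rw [h2, hu, show (2 * 2 : ZMod 4) = 0 by decide, φ.map_zero]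
    · rw [h3, h.map_add_of_mem c hvF, hu, add_zero, show (2 * 3 : ZMod 4) = 2 by decide, h2]
  have hcirc : ∀ x y, φ (circZ4 x y) = circ (φ x) (φ y) := by
    intro x y
    have h0 : φ x + φ y + φ (2 * x * y) = φ (circZ4 x y) := by simp [circZ4]
    rw [← h0]
    rcases cases4 y with rfl | rfl | rfl | rfl
    · rw [h.circ_of_mem _ _ (by simp)]; simp
    · rw [h.circ_of_notMem _ _ (hφ ▸ hc), hf, mul_one]
    · rw [h.circ_of_mem _ _ (h2 ▸ hvF), show 2 * x * 2 = 0 by clear h0; revert x; decide,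
        φ.map_zero, add_zero]
    · rw [h.circ_of_notMem _ _ (h3 ▸ hcv), hf,
        show 2 * x * 3 = 2 * x by clear h0; revert x; decide]
  let e := AddEquiv.ofBijective φ ⟨inj, surj⟩
  refine ⟨e.symm, fun a b => ?_⟩
  apply e.injective
  obtain ⟨x, rfl⟩ := e.surjective a
  obtain ⟨y, rfl⟩ := e.surjective b
  simp only [AddEquiv.apply_symm_apply, AddEquiv.symm_apply_apply]
  exact (hcirc x y).symm

theorem exists_equiv_circZ2Z2 (h : IsShiftedAddition F f circ) {c : M} (hc : c ∉ F)
    (hu : f (f c) = 0) (hv : f c ≠ 0) (hcc : c + c = 0) :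
    ∃ e : M ≃+ ZMod 2 × ZMod 2, ∀ a b, e (circ a b) = circZ2Z2 (e a) (e b) := by
  have hvF := h.map_mem c
  obtain ⟨α, hα⟩ := exists_zmodHom 2 (f c) (by rw [two_nsmul, h.add_self _ hvF])
  obtain ⟨β, hβ⟩ := exists_zmodHom 2 c (by rw [two_nsmul, hcc])
  have cases2 : ∀ y : ZMod 2, y = 0 ∨ y = 1 := by decide
  let φ : ZMod 2 × ZMod 2 →+ M := α.coprod β
  have hφ : ∀ x y, φ (x, y) = α x + β y := fun _ _ => rfl
  have hαF : ∀ x, α x ∈ F := by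
    intro x
    rcases cases2 x with rfl | rfl
    · simp
    · rwa [hα]
  have hfα : ∀ x, f (α x) = 0 := by
    intro x
    rcases cases2 x with rfl | rfl
    · simp [h.map_zero]
    · rw [hα, hu]
  have hαc : ∀ x, α x + β 1 ∉ F := by
    intro x
    rwa [hβ, F.add_mem_cancel_left (hαF x)]
  have inj : Function.Injective φ := by
    rw [injective_iff_map_eq_zero]
    rintro ⟨x, y⟩ hy
    rw [hφ] at hy
    rcases cases2 y with rfl | rfl
    · rcases cases2 x with rfl | rfl
      · rfl
      · rw [β.map_zero, add_zero, hα] at hy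
        exact absurd hy hv
    · exact absurd (hy ▸ F.zero_mem) (hαc x)
  have surj : Function.Surjective φ := by
    have key : ∀ x ∈ F, ∃ y, φ y = x := by
      intro x hx
      rcases h.eq_of_mem hc hx with rfl | rfl | rfl | rfl
      · exact ⟨0, φ.map_zero⟩
      · exact ⟨0, by rw [φ.map_zero, hu]⟩
      · exact ⟨(1, 0), by rw [hφ, hα, β.map_zero, add_zero]⟩
      · exact ⟨(1, 0), by rw [hφ, hα, β.map_zero, hu]⟩
    intro b
    by_cases hb : b ∈ F
    · exact key b hb
    · obtain ⟨y, hy⟩ := key _ (h.sub_mem hb hc)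
      refine ⟨y + (0, 1), ?_⟩
      rw [_root_.map_add, hy, hφ, α.map_zero, hβ, zero_add, sub_add_cancel]
  have hf : ∀ x y, f (φ (x, y)) = φ (y, 0) := by
    intro x y
    rw [hφ, hφ, add_comm, h.map_add_of_mem _ (hαF x), hfα, β.map_zero]
    rcases cases2 y with rfl | rfl
    · simp [h.map_zero]
    · rw [hα, hβ]
  have hcirc : ∀ x y, φ (circZ2Z2 x y) = circ (φ x) (φ y) := by
    rintro ⟨x, x'⟩ ⟨y, y'⟩
    have h0 : φ (x, x') + φ (y, y') + φ (x' * y', 0) = φ (circZ2Z2 (x, x') (y, y')) := by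
      rw [← _root_.map_add, ← _root_.map_add]
      simp [circZ2Z2]
    rw [← h0]
    rcases cases2 y' with rfl | rfl
    · rw [h.circ_of_mem _ _ (by rw [hφ, β.map_zero, add_zero]; exact hαF y), mul_zero,
        show φ (0, 0) = 0 from φ.map_zero, add_zero]
    · rw [h.circ_of_notMem _ _ (by rw [hφ]; exact hαc y), hf, mul_one]
  let e := AddEquiv.ofBijective φ ⟨inj, surj⟩
  refine ⟨e.symm, fun a b => ?_⟩
  apply e.injective
  obtain ⟨x, rfl⟩ := e.surjective a
  obtain ⟨y, rfl⟩ := e.surjective b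
  simp only [AddEquiv.apply_symm_apply, AddEquiv.symm_apply_apply]
  exact (hcirc x y).symm

theorem exists_equiv_circZ2Z4 (h : IsShiftedAddition F f circ) {c : M} (hc : c ∉ F)
    (hu : f (f c) ≠ 0) (hcc : c + c = f c) :
    ∃ e : M ≃+ ZMod 2 × ZMod 4, ∀ a b, e (circ a b) = circZ2Z4 (e a) (e b) := by
  have hvF := h.map_mem c
  have huF := h.map_mem (f c)
  have hfu : f (f (f c)) = 0 := h.map_map_of_mem hvF
  obtain ⟨α, hα⟩ := exists_zmodHom 2 (f (f c)) (by rw [two_nsmul, h.add_self _ huF])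
  obtain ⟨β, hβ⟩ := exists_zmodHom 4 c (by
    rw [show 4 • c = (c + c) + (c + c) by abel, hcc, h.add_self _ hvF])
  have cases2 : ∀ y : ZMod 2, y = 0 ∨ y = 1 := by decide
  have cases4 : ∀ y : ZMod 4, y = 0 ∨ y = 1 ∨ y = 2 ∨ y = 3 := by decide
  let φ : ZMod 2 × ZMod 4 →+ M := α.coprod β
  have hφ : ∀ x y, φ (x, y) = α x + β y := fun _ _ => rfl
  have h2 : β 2 = f c := by
    rw [show (2 : ZMod 4) = 1 + 1 by decide, _root_.map_add, hβ, hcc]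
  have h3 : β 3 = c + f c := by
    rw [show (3 : ZMod 4) = 1 + 2 by decide, _root_.map_add, hβ, h2]
  have hαF : ∀ x, α x ∈ F := by
    intro x
    rcases cases2 x with rfl | rfl
    · simp
    · rwa [hα]
  have hfα : ∀ x, f (α x) = 0 := by
    intro x
    rcases cases2 x with rfl | rfl
    · simp [h.map_zero]
    · rw [hα, hfu]
  have hα1 : ∀ x, φ (x, 1) ∉ F := by
    intro x
    rwa [hφ, hβ, F.add_mem_cancel_left (hαF x)]
  have hα3 : ∀ x, φ (x, 3) ∉ F := by
    intro x
    rwa [hφ, h3, F.add_mem_cancel_left (hαF x), F.add_mem_cancel_right hvF]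
  have inj : Function.Injective φ := by
    rw [injective_iff_map_eq_zero]
    rintro ⟨x, y⟩ hy
    rcases cases4 y with rfl | rfl | rfl | rfl
    · rcases cases2 x with rfl | rfl
      · rfl
      · rw [hφ, β.map_zero, add_zero, hα] at hy
        exact absurd hy hu
    · exact absurd (hy ▸ F.zero_mem) (hα1 x)
    -- `f` separates this element from `0`: it kills the `α` part and sends `β 2 = f c` to `f (f c)
    -- ≠ 0`.
    · have h4 := congrArg f hy
      rw [hφ, h.map_add_of_mem _ (h2 ▸ hvF), hfα, h2, zero_add, h.map_zero] at h4
      exact absurd h4 hu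
    · exact absurd (hy ▸ F.zero_mem) (hα3 x)
  have surj : Function.Surjective φ := by
    have key : ∀ x ∈ F, ∃ y, φ y = x := by
      intro x hx
      rcases h.eq_of_mem hc hx with rfl | rfl | rfl | rfl
      · exact ⟨0, φ.map_zero⟩
      · exact ⟨(1, 0), by rw [hφ, hα, β.map_zero, add_zero]⟩
      · exact ⟨(0, 2), by rw [hφ, h2, α.map_zero, zero_add]⟩
      · exact ⟨(1, 2), by rw [hφ, hα, h2, add_comm]⟩
    intro b
    by_cases hb : b ∈ F
    · exact key b hb
    · obtain ⟨y, hy⟩ := key _ (h.sub_mem hb hc)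
      refine ⟨y + (0, 1), ?_⟩
      rw [_root_.map_add, hy, hφ, α.map_zero, hβ, zero_add, sub_add_cancel]
  have hf : ∀ x y, f (φ (x, y)) = φ (sumBelow y, 2 * y) := by
    intro x y
    rw [hφ, hφ, add_comm, h.map_add_of_mem _ (hαF x), hfα, add_zero]
    rcases cases4 y with rfl | rfl | rfl | rfl
    · rw [show sumBelow 0 = 0 by decide]; simp [h.map_zero]
    · rw [show sumBelow 1 = 0 by decide, hβ, mul_one, h2, α.map_zero, zero_add]
    · rw [show sumBelow 2 = 1 by decide, show (2 * 2 : ZMod 4) = 0 by decide, h2, hα,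
        β.map_zero, add_zero]
    · rw [show sumBelow 3 = 1 by decide, show (2 * 3 : ZMod 4) = 2 by decide, h3, h2, hα,
        h.map_add_of_mem _ hvF, add_comm]
  have hcirc : ∀ x y, φ (circZ2Z4 x y) = circ (φ x) (φ y) := by
    rintro ⟨x, x'⟩ ⟨y, y'⟩
    have h0 : φ (x, x') + φ (y, y') + φ ((y'.val : ZMod 2) * sumBelow x', 2 * x' * y') =
        φ (circZ2Z4 (x, x') (y, y')) := by
      rw [← _root_.map_add, ← _root_.map_add]
      rfl
    rw [← h0]
    -- The correction term depends only on the parity of `y'`, which tells whether the right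
    -- argument lies in `F`.
    have e0 : (((0 : ZMod 4).val : ZMod 2) * sumBelow x', 2 * x' * 0) = 0 := by
      clear h0; revert x'; decide
    have e1 : (((1 : ZMod 4).val : ZMod 2) * sumBelow x', 2 * x' * 1) = (sumBelow x', 2 * x') := by
      clear h0; revert x'; decide
    have e2 : (((2 : ZMod 4).val : ZMod 2) * sumBelow x', 2 * x' * 2) = 0 := by
      clear h0 e0 e1; revert x'; decide
    have e3 : (((3 : ZMod 4).val : ZMod 2) * sumBelow x', 2 * x' * 3) = (sumBelow x', 2 * x') := by
      clear h0 e0 e1 e2; revert x'; decide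
    rcases cases4 y' with rfl | rfl | rfl | rfl
    · rw [h.circ_of_mem _ _ (by rw [hφ, β.map_zero, add_zero]; exact hαF y), e0, φ.map_zero,
        add_zero]
    · rw [h.circ_of_notMem _ _ (hα1 y), hf, e1]
    · rw [h.circ_of_mem _ _ (by rw [hφ, h2]; exact F.add_mem (hαF y) hvF), e2, φ.map_zero,
        add_zero]
    · rw [h.circ_of_notMem _ _ (hα3 y), hf, e3]
  let e := AddEquiv.ofBijective φ ⟨inj, surj⟩
  refine ⟨e.symm, fun a b => ?_⟩
  apply e.injective
  obtain ⟨x, rfl⟩ := e.surjective a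
  obtain ⟨y, rfl⟩ := e.surjective b
  simp only [AddEquiv.apply_symm_apply, AddEquiv.symm_apply_apply]
  exact (hcirc x y).symm

theorem classification (h : IsShiftedAddition F f circ) (hF : F ≠ ⊥) :
    (∃ e : M ≃+ ZMod 4, ∀ a b, e (circ a b) = circZ4 (e a) (e b)) ∨
    (∃ e : M ≃+ ZMod 2 × ZMod 2, ∀ a b, e (circ a b) = circZ2Z2 (e a) (e b)) ∨
    (∃ e : M ≃+ ZMod 2 × ZMod 4, ∀ a b, e (circ a b) = circZ2Z4 (e a) (e b)) := by
  obtain ⟨c, hc⟩ := h.exists_notMem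
  have hvF := h.map_mem c
  have huF := h.map_mem (f c)
  have hccF : c + c ∈ F := h.add_mem hc hc
  by_cases hu : f (f c) = 0
  · have hv : f c ≠ 0 := by
      intro hv
      refine hF ((AddSubgroup.eq_bot_iff_forall F).2 fun x hx => ?_)
      rcases h.eq_of_mem hc hx with h1 | h1 | h1 | h1 <;> simp [h1, hv, h.map_zero]
    have : c + c = 0 ∨ c + c = f c := by
      rcases h.eq_of_mem hc hccF with h1 | h1 | h1 | h1 <;> simp [h1, hu]
    rcases this with hcc | hcc
    · exact .inr (.inl (h.exists_equiv_circZ2Z2 hc hu hv hcc))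
    · exact .inl (h.exists_equiv_circZ4 hc hu hv hcc)
  · right; right
    -- `f (c + c) + f (f c) = f c + f c = 0`, so `c + c` cannot be `0` or `f (f c)`, both of which
    -- `f` kills.
    have h1 : f (c + c) ≠ 0 := by
      intro h0
      have h2 := h.map_add_of_notMem c hc
      rw [h0, zero_add, h.add_self _ hvF] at h2
      exact hu h2
    rcases h.eq_of_mem hc hccF with hcc | hcc | hcc | hcc
    · exact absurd (by rw [hcc, h.map_zero]) h1
    · exact absurd (by rw [hcc, h.map_map_of_mem hvF]) h1
    · exact h.exists_equiv_circZ2Z4 hc hu hcc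
    · have hf : f (c + f c) = f c + f (f c) := h.map_add_of_mem c hvF
      -- Replacing `c` by `c + f c` leaves its double unchanged, while its image under `f` becomes
      -- `f c + f (f c)`, which is that double.
      refine h.exists_equiv_circZ2Z4 (c := c + f c) ?_ ?_ ?_
      · rwa [F.add_mem_cancel_right hvF]
      · rwa [hf, h.map_add_of_mem _ huF, h.map_map_of_mem hvF, add_zero]
      · rw [hf, ← hcc, add_add_add_comm, h.add_self _ hvF, add_zero]

end IsShiftedAddition

/-! ### From one nontrivial orbit to a shifted addition -/

namespace SkewBrace

variable {B : Type*} [SkewBrace B]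

theorem lambdaAut_mul (a b x : B) : lambdaAut (a * b) x = lambdaAut a (lambdaAut b x) :=
  congrArg (fun g : Multiplicative (AddAut B) => g.toAdd x) ((lambda B).map_mul a b)

theorem lambdaAut_one (x : B) : lambdaAut (1 : B) x = x :=
  congrArg (fun g : Multiplicative (AddAut B) => g.toAdd x) (lambda B).map_one

theorem mul_eq_add_lambdaAut (a b : B) : a * b = a + lambdaAut a b :=
  (add_neg_cancel_left a (a * b)).symm

theorem mem_actionOrbit_lambda {x y : B} :
    y ∈ actionOrbit (lambda B) x ↔ ∃ a : B, lambdaAut a x = y :=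
  Iff.rfl

/-- The action of `(B, ∘)` on `B` by the maps `λ_a`. -/
abbrev lambdaAction (B : Type*) [SkewBrace B] : MulAction B B where
  smul a x := lambdaAut a x
  one_smul := lambdaAut_one
  mul_smul := lambdaAut_mul

theorem ncard_actionOrbit_lambda_dvd (x : B) :
    (actionOrbit (lambda B) x).ncard ∣ Nat.card B := by
  have h := (@MulAction.stabilizer B B _ (lambdaAction B) x).index_dvd_card
  rw [@MulAction.index_stabilizer B B _ (lambdaAction B) x] at h
  exact h

/-- The subgroup of `(B, +)` of elements fixed by all `λ_a`. -/
def fixedPoints (B : Type*) [SkewBrace B] : AddSubgroup B where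
  carrier := {x | ∀ a : B, lambdaAut a x = x}
  zero_mem' a := map_zero _
  add_mem' hx hy a := by rw [map_add, hx a, hy a]
  neg_mem' hx a := by rw [map_neg, hx a]

theorem mem_fixedPoints {x : B} : x ∈ fixedPoints B ↔ ∀ a : B, lambdaAut a x = x :=
  Iff.rfl

theorem self_mem_actionOrbit (x : B) : x ∈ actionOrbit (lambda B) x :=
  mem_actionOrbit_lambda.2 ⟨1, lambdaAut_one x⟩

theorem one_lt_ncard_actionOrbit_iff [Finite B] {x : B} :
    1 < (actionOrbit (lambda B) x).ncard ↔ x ∉ fixedPoints B := by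
  rw [Set.one_lt_ncard (Set.toFinite _)]
  constructor
  · rintro ⟨_, ⟨a, rfl⟩, _, ⟨b, rfl⟩, hne⟩ hx
    exact hne ((hx a).trans (hx b).symm)
  · intro hx
    rw [mem_fixedPoints, not_forall] at hx
    obtain ⟨a, ha⟩ := hx
    exact ⟨_, ⟨a, rfl⟩, x, self_mem_actionOrbit x, ha⟩

theorem lambdaAut_mem_fixedPoints_iff {a x : B} :
    lambdaAut a x ∈ fixedPoints B ↔ x ∈ fixedPoints B := by
  constructor
  · intro h
    have h1 := h a⁻¹
    rw [← lambdaAut_mul, inv_mul_cancel, lambdaAut_one] at h1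
    rwa [h1]
  · intro h
    rwa [h a]

/-- If the `λ`-graph has exactly one vertex, then `λ` is transitive on the elements that are not
fixed, and there are such elements. -/
theorem exists_actionOrbit_eq_compl [Finite B] (hone : HasExactlyOneVertex (lambdaGraph B)) :
    ∃ c : B, c ∉ fixedPoints B ∧ actionOrbit (lambda B) c = (fixedPoints B : Set B)ᶜ := by
  obtain ⟨hs, ⟨⟨_, ⟨c, rfl⟩, hc⟩⟩⟩ := Nat.card_eq_one_iff_unique.1 hone
  rw [one_lt_ncard_actionOrbit_iff] at hc
  refine ⟨c, hc, Set.Subset.antisymm ?_ fun x hx => ?_⟩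
  · rintro _ ⟨a, rfl⟩ h
    exact hc (lambdaAut_mem_fixedPoints_iff.1 h)
  · have h1 := congrArg Subtype.val (hs.elim
      (⟨_, ⟨c, rfl⟩, one_lt_ncard_actionOrbit_iff.2 hc⟩ : NontrivialOrbit (lambda B))
      ⟨_, ⟨x, rfl⟩, one_lt_ncard_actionOrbit_iff.2 hx⟩)
    change actionOrbit (lambda B) c = actionOrbit (lambda B) x at h1
    exact h1 ▸ self_mem_actionOrbit x

theorem index_fixedPoints_eq_two [Finite B] {c : B} (hc : c ∉ fixedPoints B)
    (horb : actionOrbit (lambda B) c = (fixedPoints B : Set B)ᶜ) :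
    (fixedPoints B).index = 2 := by
  have hdvd := ncard_actionOrbit_lambda_dvd c
  have hcard := (fixedPoints B).card_mul_index
  have hcompl := Set.ncard_add_ncard_compl (fixedPoints B : Set B)
  rw [← horb, ← Nat.card_coe_set_eq] at hcompl
  change Nat.card (fixedPoints B) + _ = _ at hcompl
  have hpos : 0 < Nat.card (fixedPoints B) := Nat.card_pos
  have hne1 : (fixedPoints B).index ≠ 1 := fun h => hc (by
    rw [AddSubgroup.index_eq_one.1 h]; exact AddSubgroup.mem_top c)
  have hne0 : (fixedPoints B).index ≠ 0 := AddSubgroup.index_ne_zero_of_finite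
  obtain ⟨k, hk⟩ : ∃ k, (fixedPoints B).index = k + 1 := Nat.exists_eq_succ_of_ne_zero hne0
  rw [hk] at hcard
  have hL : (actionOrbit (lambda B) c).ncard = Nat.card (fixedPoints B) * k := by
    rw [← hcard, mul_add, mul_one] at hcompl
    omega
  rw [hL, ← hcard] at hdvd
  -- The orbit has size `|F| * k` and `|B| = |F| * (k + 1)`, so `k` divides `k + 1`.
  have h1 : k ∣ 1 := (Nat.dvd_add_right dvd_rfl).1 (Nat.dvd_of_mul_dvd_mul_left hpos hdvd)
  rw [hk, Nat.dvd_one.1 h1]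

/-- The additive group of a skew brace of abelian type. -/
abbrev IsOfAbelianType.addCommGroup (hab : IsOfAbelianType B) : AddCommGroup B where
  add_comm := hab

theorem isShiftedAddition (hab : IsOfAbelianType B) {c : B}
    (hc : c ∉ fixedPoints B) (hidx : (fixedPoints B).index = 2)
    (horb : actionOrbit (lambda B) c = (fixedPoints B : Set B)ᶜ) :
    @IsShiftedAddition B hab.addCommGroup (fixedPoints B) (fun a => -c + lambdaAut a c)
      (fun a b => a * b) := by
  have mem_iff := fun a b : B => AddSubgroup.add_mem_iff_of_index_two (a := a) (b := b) hidx
  have hmem : ∀ a, -c + lambdaAut a c ∈ fixedPoints B := by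
    intro a
    rw [mem_iff, neg_mem_iff, lambdaAut_mem_fixedPoints_iff]
  have hself : ∀ a, (-c + lambdaAut a c) + (-c + lambdaAut a c) = 0 := by
    intro a
    -- Index two puts `c + c` in `F`, so `λ_a` fixes it; this is what gives `F` exponent two.
    have h1 : lambdaAut a (c + c) = c + c := (mem_iff c c).2 Iff.rfl a
    rw [map_add] at h1
    have h2 : (-c + lambdaAut a c) + (-c + lambdaAut a c) =
        -(c + c) + (lambdaAut a c + lambdaAut a c) := by
      let _ := hab.addCommGroup
      abel
    rw [h2, h1, neg_add_cancel]
  have hsurj : ∀ x ∈ fixedPoints B, ∃ a, -c + lambdaAut a c = x := by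
    intro x hx
    have h1 : c + x ∈ actionOrbit (lambda B) c := by
      rw [horb]
      exact fun h => hc ((AddSubgroup.add_mem_cancel_right _ hx).1 h)
    obtain ⟨a, ha⟩ := mem_actionOrbit_lambda.1 h1
    exact ⟨a, by rw [ha, neg_add_cancel_left]⟩
  let _ := hab.addCommGroup
  refine ⟨hidx, ?_, hmem, hsurj, ?_, ?_, ?_⟩
  · intro x hx
    obtain ⟨a, rfl⟩ := hsurj x hx
    exact hself a
  · intro a b hb
    change a * b = a + b
    rw [mul_eq_add_lambdaAut, hb a]
  · intro a b hb
    have h1 : -c + b ∈ fixedPoints B := by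
      rw [mem_iff, neg_mem_iff]
      tauto
    have h2 := h1 a
    rw [map_add, map_neg] at h2
    have h3 : lambdaAut a b = lambdaAut a c + (-c + b) := by
      rw [← h2, add_neg_cancel_left]
    change a * b = a + b + (-c + lambdaAut a c)
    rw [mul_eq_add_lambdaAut, h3]
    abel
  · intro a b
    have h2 := hmem b a
    rw [map_add, map_neg] at h2
    have h3 : lambdaAut a (lambdaAut b c) = lambdaAut a c + (-c + lambdaAut b c) := by
      rw [← h2, add_neg_cancel_left]
    change -c + lambdaAut (a * b) c = (-c + lambdaAut a c) + (-c + lambdaAut b c)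
    rw [lambdaAut_mul, h3, add_assoc]

/-- Some `λ_a` moves `c`, and by index two the difference is a nonzero element of `F`. -/
theorem fixedPoints_ne_bot [Finite B] {c : B} (hc : c ∉ fixedPoints B)
    (hidx : (fixedPoints B).index = 2) : fixedPoints B ≠ ⊥ := by
  intro h
  rw [mem_fixedPoints, not_forall] at hc
  obtain ⟨a, ha⟩ := hc
  have h1 : -c + lambdaAut a c ∈ fixedPoints B := by
    rw [AddSubgroup.add_mem_iff_of_index_two hidx, neg_mem_iff, lambdaAut_mem_fixedPoints_iff]
  rw [h, AddSubgroup.mem_bot, neg_add_eq_zero] at h1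
  exact ha h1.symm

end SkewBrace

theorem mainTheorem10 {B : Type*} [SkewBrace B] [Finite B]
    (hab : SkewBrace.IsOfAbelianType B)
    (hone : HasExactlyOneVertex (lambdaGraph B)) :
    (Nonempty (SkewBrace.Iso B BraceZ4) ∨
      Nonempty (SkewBrace.Iso B BraceZ2Z2) ∨
      Nonempty (SkewBrace.Iso B BraceZ2Z4)) ∧
    Nat.card B ≤ 8 := by
  obtain ⟨c, hc, horb⟩ := SkewBrace.exists_actionOrbit_eq_compl hone
  have hidx := SkewBrace.index_fixedPoints_eq_two hc horb
  rcases @IsShiftedAddition.classification B hab.addCommGroup _ _ _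
    (SkewBrace.isShiftedAddition hab hc hidx horb) (SkewBrace.fixedPoints_ne_bot hc hidx) with ⟨e, he⟩ | ⟨e, he⟩ | ⟨e, he⟩
  · exact ⟨.inl ⟨⟨e.toEquiv, e.map_add, he⟩⟩, by simp [Nat.card_congr e.toEquiv]⟩
  · exact ⟨.inr (.inl ⟨⟨e.toEquiv, e.map_add, he⟩⟩), by simp [Nat.card_congr e.toEquiv]⟩
  · exact ⟨.inr (.inr ⟨⟨e.toEquiv, e.map_add, he⟩⟩), by simp [Nat.card_congr e.toEquiv]⟩
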